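/- Let $\psi=(\psi_n)_{n\ge 0}\in\ell^2(\mathbb N,\mathbb C)$ with $\sum_n|\psi_n|^2=1$ be a pure state $|\psi\rangle=\sum_n\psi_n|n\rangle$ of one bosonic mode, written in the Fock basis. For $T\in[0,1]$ let $B(T)=\exp\big(\arccos\sqrt T\,(ab^\dagger-a^\dagger b)\big)$ be the beam splitter of transmission probability $T$ acting on the modes annihilated by $a$ and $b$, and put $$|\Psi_T\rangle=B(T)|\psi,0\rangle=\sum_n\psi_n\sum_{m=0}^n\sqrt{\tbinom nm T^m(1-T)^{n-m}}\;|m,n-m\rangle,\qquad \rho_T=\mathrm{Tr}_b\,|\Psi_T\rangle\langle\Psi_T|,$$ so that $\rho_T$ is the state $\psi$ subject to loss with transmission probability $T$. Let $\mathcal P_\psi(T)=\mathrm{Tr}[\rho_T^2]$ be the purity and $\mathcal M_\psi(T)=1-\mathcal P_\psi(T)$ the mixedness. Then, for every such $\psi$: 1. for every $T\in(0,1)$, $|\Psi_T\rangle$ is a unit vector and the series defining $\mathrm{Tr}[\rho_T^2]$ in the Fock basis converge, to a real number; 2. $\mathcal P_\psi$ is convex on $(0,1)$ and $\mathcal M_\psi$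 is concave on $(0,1)$; 3. $\mathcal P_\psi$ is twice continuously differentiable on $(0,1)$, and $\partial^2\mathcal P_\psi(T)/\partial T^2\ge 0$ for all $T\in(0,1)$; 4. there are coefficients $p_m\ge 0$ ($m\ge 0$), with $p_m=0$ for all odd $m$, such that $\mathcal P_\psi(T)=\sum_{m\ge 0}p_m(1-2T)^m$ for all $T\in(0,1)$. -/

import Mathlib

noncomputable section

namespace PhotonLoss

open scoped Nat

/-- Fock-basis coefficient functions of one bosonic mode: `φ n` is the coefficient of `|n⟩`.
The physical pure states are the unit vectors of the subspace `lp (fun _ : ℕ => ℂ) 2`. -/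
abbrev Mode : Type := ℕ → ℂ

/-- Fock-basis coefficient functions of two bosonic modes `a`, `b`:
`Φ (m, k)` is the coefficient of `|m, k⟩`. -/
abbrev TwoMode : Type := ℕ × ℕ → ℂ

/-- `a |m, k⟩ = √m |m - 1, k⟩`, written on coefficients. -/
def annA : Module.End ℂ TwoMode where
  toFun Φ := fun p => (√((p.1 : ℝ) + 1) : ℝ) * Φ (p.1 + 1, p.2)
  map_add' Φ Φ' := by funext p; simp [mul_add]
  map_smul' c Φ := by funext p; simp [mul_left_comm]

/-- `a† |m, k⟩ = √(m + 1) |m + 1, k⟩`, written on coefficients. -/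
def creA : Module.End ℂ TwoMode where
  toFun Φ := fun p => (√(p.1 : ℝ) : ℝ) * Φ (p.1 - 1, p.2)
  map_add' Φ Φ' := by funext p; simp [mul_add]
  map_smul' c Φ := by funext p; simp [mul_left_comm]

/-- `b |m, k⟩ = √k |m, k - 1⟩`, written on coefficients. -/
def annB : Module.End ℂ TwoMode where
  toFun Φ := fun p => (√((p.2 : ℝ) + 1) : ℝ) * Φ (p.1, p.2 + 1)
  map_add' Φ Φ' := by funext p; simp [mul_add]
  map_smul' c Φ := by funext p; simp [mul_left_comm]

/-- `b† |m, k⟩ = √(k + 1) |m, k + 1⟩`, written on coefficients. -/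
def creB : Module.End ℂ TwoMode where
  toFun Φ := fun p => (√(p.2 : ℝ) : ℝ) * Φ (p.1, p.2 - 1)
  map_add' Φ Φ' := by funext p; simp [mul_add]
  map_smul' c Φ := by funext p; simp [mul_left_comm]

/-- The beam-splitter generator `a b† - a† b`. It preserves the total photon number, so it acts
on each of the finite-dimensional spaces spanned by the `|m, k⟩` with `m + k = N`. -/
def bsGenerator : Module.End ℂ TwoMode := annA * creB - creA * annB

/-- The beam splitter `B(T) = exp (arccos √T (a b† - a† b))` of transmission probability `T`, as
the exponential series. Each coefficient of `B(T) Φ` involves only the finite-dimensional sector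
of its total photon number, so the series converges in every coefficient. -/
def beamSplitter (T : ℝ) (Φ : TwoMode) : TwoMode :=
  fun p => ∑' r : ℕ, ((r ! : ℂ)⁻¹ * (Real.arccos (√T) : ℂ) ^ r) * (bsGenerator ^ r) Φ p

/-- `|ψ, 0⟩`: the mode `a` in state `ψ`, the mode `b` in the vacuum. -/
def withVacuum (ψ : Mode) : TwoMode := fun p => if p.2 = 0 then ψ p.1 else 0

/-- `|Ψ_T⟩ = B(T) |ψ, 0⟩`. -/
def outputState (ψ : Mode) (T : ℝ) : TwoMode := beamSplitter T (withVacuum ψ)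

/-- The matrix of `|Φ⟩⟨Φ|`. -/
def projector (Φ : TwoMode) : Matrix (ℕ × ℕ) (ℕ × ℕ) ℂ := Matrix.vecMulVec Φ (star Φ)

/-- The partial trace over the mode `b`. -/
def partialTraceB (R : Matrix (ℕ × ℕ) (ℕ × ℕ) ℂ) : Matrix ℕ ℕ ℂ :=
  Matrix.of fun m n => ∑' k : ℕ, R (m, k) (n, k)

/-- `ρ_T = Tr_b |Ψ_T⟩⟨Ψ_T|`, the pure state `ψ` subject to loss with transmission
probability `T`, as a density matrix in the Fock basis. -/
def lossyState (ψ : Mode) (T : ℝ) : Matrix ℕ ℕ ℂ := partialTraceB (projector (outputState ψ T))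

/-- The product of two infinite matrices. -/
def matMul (A B : Matrix ℕ ℕ ℂ) : Matrix ℕ ℕ ℂ := Matrix.of fun i j => ∑' k : ℕ, A i k * B k j

/-- The trace of an infinite matrix. -/
def matTrace (A : Matrix ℕ ℕ ℂ) : ℂ := ∑' m : ℕ, A m m

/-- The purity `P_ψ(T) = Tr[ρ_T ^ 2]` (a real number). -/
def purity (ψ : Mode) (T : ℝ) : ℝ := (matTrace (matMul (lossyState ψ T) (lossyState ψ T))).re

/-- The mixedness (linear entropy) `M_ψ(T) = 1 - P_ψ(T)`. -/
def mixedness (ψ : Mode) (T : ℝ) : ℝ := 1 - purity ψ T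

theorem bsGenerator_apply (Φ : TwoMode) (m k : ℕ) :
    bsGenerator Φ (m, k) = (√((m : ℝ) + 1) : ℝ) * ((√(k : ℝ) : ℝ) * Φ (m + 1, k - 1)) -
      (√(m : ℝ) : ℝ) * ((√((k : ℝ) + 1) : ℝ) * Φ (m - 1, k + 1)) := rfl

/-- The state `|ψ, 0⟩` rotated by a complex angle `z`. -/
def rotated (ψ : Mode) (z : ℂ) : TwoMode := fun p =>
  ψ (p.1 + p.2) * (√((p.1 + p.2).choose p.1 : ℝ) : ℝ) * (Complex.cos z ^ p.1 * Complex.sin z ^ p.2)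

theorem rotated_zero (ψ : Mode) : rotated ψ 0 = withVacuum ψ := by
  funext ⟨m, k⟩
  rcases Nat.eq_zero_or_pos k with rfl | hk
  · simp [rotated, withVacuum]
  · simp [rotated, withVacuum, hk.ne']

theorem hasDerivAt_rotated (ψ : Mode) (p : ℕ × ℕ) (z : ℂ) :
    HasDerivAt (fun z => rotated ψ z p) (bsGenerator (rotated ψ z) p) z := by
  obtain ⟨m, k⟩ := p
  have h := (((Complex.hasDerivAt_cos z).pow m).mul ((Complex.hasDerivAt_sin z).pow k)).const_mul
    (ψ (m + k) * ((√((m + k).choose m : ℝ) : ℝ) : ℂ))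
  refine h.congr_deriv ?_
  rw [bsGenerator_apply]
  have e1 : ((√((m : ℝ) + 1) : ℝ) : ℂ) * (((√(k : ℝ) : ℝ) : ℂ) * rotated ψ z (m + 1, k - 1)) =
      ψ (m + k) * ((√((m + k).choose m : ℝ) : ℝ) : ℂ) *
        (Complex.cos z ^ m * (k * Complex.sin z ^ (k - 1) * Complex.cos z)) := by
    rcases k with _ | k
    · simp
    · have hc : √((m : ℝ) + 1) * √((k + 1 : ℕ) : ℝ) * √((m + 1 + k).choose (m + 1) : ℝ) =
          ((k + 1 : ℕ) : ℝ) * √((m + 1 + k).choose m : ℝ) := by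
        have hn : ((m : ℝ) + 1) * ((m + 1 + k).choose (m + 1) : ℝ) =
            ((k + 1 : ℕ) : ℝ) * ((m + 1 + k).choose m : ℝ) := by
          have := Nat.choose_succ_right_eq (m + 1 + k) m
          have h2 : m + 1 + k - m = k + 1 := by omega
          rw [h2] at this
          have h3 : (((m + 1 + k).choose (m + 1) * (m + 1) : ℕ) : ℝ) =
            (((m + 1 + k).choose m * (k + 1) : ℕ) : ℝ) := by rw [this]
          push_cast at h3 ⊢
          linarith
        rw [mul_right_comm, ← Real.sqrt_mul (by positivity), hn, Real.sqrt_mul (by positivity),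
          mul_right_comm, Real.mul_self_sqrt (by positivity)]
      have hc' := congrArg (fun x : ℝ => (x : ℂ)) hc
      simp only [Complex.ofReal_mul] at hc'
      have h4 : m + (k + 1) = m + 1 + k := by omega
      simp only [rotated, Nat.add_sub_cancel, h4]
      rw [pow_succ]
      linear_combination (ψ (m + 1 + k) * Complex.cos z ^ m * Complex.cos z *
        Complex.sin z ^ k) * hc'
  have e2 : ((√(m : ℝ) : ℝ) : ℂ) * (((√((k : ℝ) + 1) : ℝ) : ℂ) * rotated ψ z (m - 1, k + 1)) =
      ψ (m + k) * ((√((m + k).choose m : ℝ) : ℝ) : ℂ) *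
        ((m * Complex.cos z ^ (m - 1) * Complex.sin z) * Complex.sin z ^ k) := by
    rcases m with _ | m
    · simp
    · have hc : √((m + 1 : ℕ) : ℝ) * √((k : ℝ) + 1) * √((m + 1 + k).choose m : ℝ) =
          ((m + 1 : ℕ) : ℝ) * √((m + 1 + k).choose (m + 1) : ℝ) := by
        have hn : ((k : ℝ) + 1) * ((m + 1 + k).choose m : ℝ) =
            ((m + 1 : ℕ) : ℝ) * ((m + 1 + k).choose (m + 1) : ℝ) := by
          have := Nat.choose_succ_right_eq (m + 1 + k) m
          have h2 : m + 1 + k - m = k + 1 := by omega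
          rw [h2] at this
          have h3 : (((m + 1 + k).choose (m + 1) * (m + 1) : ℕ) : ℝ) =
            (((m + 1 + k).choose m * (k + 1) : ℕ) : ℝ) := by rw [this]
          push_cast at h3 ⊢
          linarith
        rw [mul_assoc, ← Real.sqrt_mul (by positivity), hn, Real.sqrt_mul (by positivity),
          ← mul_assoc, Real.mul_self_sqrt (by positivity)]
      have hc' := congrArg (fun x : ℝ => (x : ℂ)) hc
      simp only [Complex.ofReal_mul] at hc'
      have h4 : m + (k + 1) = m + 1 + k := by omega
      simp only [rotated, Nat.add_sub_cancel, h4]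
      rw [pow_succ]
      linear_combination (ψ (m + 1 + k) * Complex.cos z ^ m * Complex.sin z *
        Complex.sin z ^ k) * hc'
  rw [e1, e2]
  simp only [Pi.pow_apply]
  ring

theorem hasDerivAt_pow_rotated (ψ : Mode) (r : ℕ) (p : ℕ × ℕ) (z : ℂ) :
    HasDerivAt (fun z => (bsGenerator ^ r) (rotated ψ z) p)
      ((bsGenerator ^ (r + 1)) (rotated ψ z) p) z := by
  induction r generalizing p with
  | zero => simpa using hasDerivAt_rotated ψ p z
  | succ r ih =>
    obtain ⟨m, k⟩ := p
    have h := (((ih (m + 1, k - 1)).const_mul ((√(k : ℝ) : ℝ) : ℂ)).const_mul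
      ((√((m : ℝ) + 1) : ℝ) : ℂ)).sub
      (((ih (m - 1, k + 1)).const_mul ((√((k : ℝ) + 1) : ℝ) : ℂ)).const_mul ((√(m : ℝ) : ℝ) : ℂ))
    rw [pow_succ' bsGenerator (r + 1), pow_succ' bsGenerator r]
    simp only [Module.End.mul_apply, bsGenerator_apply] at h ⊢
    rw [pow_succ' bsGenerator r] at h
    exact h

/-- The exponential series that defines `B(T)|ψ, 0⟩` converges in every coefficient, and the state
is `∑ₙ ψₙ ∑ₘ √(C(n,m) T^m (1-T)^(n-m)) |m, n-m⟩`. -/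
theorem hasSum_outputState (ψ : Mode) {T : ℝ} (hT : T ∈ Set.Icc (0 : ℝ) 1) (m k : ℕ) :
    HasSum (fun r : ℕ => ((r ! : ℂ)⁻¹ * (Real.arccos (√T) : ℂ) ^ r) *
        (bsGenerator ^ r) (withVacuum ψ) (m, k))
      (ψ (m + k) * (√((m + k).choose m * T ^ m * (1 - T) ^ k) : ℝ)) := by
  have hd : Differentiable ℂ (fun z => rotated ψ z (m, k)) :=
    fun z => (hasDerivAt_rotated ψ (m, k) z).differentiableAt
  have hit : ∀ r : ℕ, iteratedDeriv r (fun z => rotated ψ z (m, k)) =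
      fun z => (bsGenerator ^ r) (rotated ψ z) (m, k) := by
    intro r
    induction r with
    | zero => simp
    | succ r ih =>
      rw [iteratedDeriv_succ, ih]
      funext z
      exact (hasDerivAt_pow_rotated ψ r (m, k) z).deriv
  have h := Complex.hasSum_taylorSeries_of_entire hd 0 (Real.arccos (√T) : ℂ)
  simp only [hit, rotated_zero, sub_zero, smul_eq_mul] at h
  have h0 : 0 ≤ √T := Real.sqrt_nonneg T
  have hcos : Complex.cos (Real.arccos (√T) : ℂ) = (√T : ℝ) := by
    rw [← Complex.ofReal_cos, Real.cos_arccos (by linarith) (Real.sqrt_le_one.mpr hT.2)]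
  have hsin : Complex.sin (Real.arccos (√T) : ℂ) = (√(1 - T) : ℝ) := by
    rw [← Complex.ofReal_sin, Real.sin_arccos, Real.sq_sqrt hT.1]
  have hv : rotated ψ (Real.arccos (√T) : ℂ) (m, k) =
      ψ (m + k) * (√((m + k).choose m * T ^ m * (1 - T) ^ k) : ℝ) := by
    have h1 : 0 ≤ 1 - T := by linarith [hT.2]
    have hp : √((m + k).choose m * T ^ m * (1 - T) ^ k) =
        √((m + k).choose m : ℝ) * (√T ^ m * √(1 - T) ^ k) := by
      rw [Real.sqrt_eq_iff_mul_self_eq (by have := hT.1; positivity) (by positivity)]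
      have a1 := Real.mul_self_sqrt (Nat.cast_nonneg (α := ℝ) ((m + k).choose m))
      have a2 : √T ^ m * √T ^ m = T ^ m := by rw [← mul_pow, Real.mul_self_sqrt hT.1]
      have a3 : √(1 - T) ^ k * √(1 - T) ^ k = (1 - T) ^ k := by
        rw [← mul_pow, Real.mul_self_sqrt h1]
      symm
      calc √((m + k).choose m : ℝ) * (√T ^ m * √(1 - T) ^ k) *
            (√((m + k).choose m : ℝ) * (√T ^ m * √(1 - T) ^ k))
          = (√((m + k).choose m : ℝ) * √((m + k).choose m : ℝ)) * (√T ^ m * √T ^ m) *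
            (√(1 - T) ^ k * √(1 - T) ^ k) := by ring
        _ = _ := by rw [a1, a2, a3]
    simp only [rotated, hcos, hsin, hp]
    push_cast
    ring
  rw [hv] at h
  simpa only [mul_assoc] using h

theorem outputState_apply (ψ : Mode) {T : ℝ} (hT : T ∈ Set.Icc (0 : ℝ) 1) (m k : ℕ) :
    outputState ψ T (m, k) = ψ (m + k) * (√((m + k).choose m * T ^ m * (1 - T) ^ k) : ℝ) :=
  (hasSum_outputState ψ hT m k).tsum_eq

end PhotonLoss

end

noncomputable section

namespace PhotonLoss

open scoped Nat ComplexConjugate TensorProduct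
open Finset.HasAntidiagonal (antidiagonal)

/-! Put f n = ψ n √(n!). Written over photon numbers m, n of mode a and k, l of mode b in two
copies, Tr ρ² has the summand T^(m+n) (1-T)^(k+l) / (m! n! k! l!) · f(m+k) f(n+l) conj(f(n+k)
f(m+l)). For total number N these are the terms of (T(xv + yu) + (1-T)(xu + yv))^N / N!, with x^i
y^j read as f i f j and u^i v^j as its conjugate. The base also equals ((1-2T)(x-y)(u-v) +
(x+y)(u+v)) / 2. Expanded this way, the coefficient of (1-2T)^r is a sum of squared moduli
(`map_beamSplitter_identity`), and exchanging x and y kills odd r (`pairAmplitude_odd`). Since 1-2T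
= 1 at T = 0, the weights are summable (`summable_purityWeight`), so the purity is a power series in
1-2T with nonnegative even coefficients; convexity holds term by term. -/

/-! ### Regrouping of infinite sums -/

theorem hasSum_sum_fiber {α β γ : Type*} [AddCommGroup γ] [UniformSpace γ] [IsUniformAddGroup γ]
    [CompleteSpace γ] [T2Space γ] {F : α → γ} {S : γ} (hF : HasSum F S) (π : α → β)
    (fib : β → Finset α) (hfib : ∀ a b, a ∈ fib b ↔ π a = b) :
    HasSum (fun b => ∑ a ∈ fib b, F a) S := by
  have h := hF.tsum_fiberwise π
  convert h using 2 with b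
  have e : π ⁻¹' {b} = (fib b : Set α) := by
    ext a
    simp [hfib]
  rw [e, Finset.tsum_subtype' (fib b) F]

theorem hasSum_of_hasSum_antidiagonal {h : ℕ × ℕ → ℝ} (h0 : ∀ p, 0 ≤ h p) {S : ℝ}
    (hS : HasSum (fun N => ∑ p ∈ antidiagonal N, h p) S) : HasSum h S := by
  have hs : Summable h := by
    rw [← Finset.HasAntidiagonal.sigmaAntidiagonalEquivProd.summable_iff, summable_sigma_of_nonneg]
    · refine ⟨fun N => Summable.of_finite, ?_⟩
      refine hS.summable.congr fun N => ?_
      rw [tsum_fintype]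
      exact (Finset.sum_coe_sort (antidiagonal N) h).symm
    · exact fun _ => h0 _
  have h1 := hasSum_sum_fiber hs.hasSum (fun p => p.1 + p.2) antidiagonal (by simp)
  rw [hS.unique h1]
  exact hs.hasSum

/-! ### Absolute convergence of the trace -/

/-- By AM-GM the term is at most |Φ(a)|²|Φ(c)|² + |Φ(b)|²|Φ(d)|². The pairs (a, c) and (b, d) are
used because in the traces below each of them determines the summation index. -/
theorem summable_overlap {β : Type*} {Φ : TwoMode} (h : Summable fun p => ‖Φ p‖ ^ 2)
    (a b c d : β → ℕ × ℕ) (hac : Function.Injective fun x => (a x, c x))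
    (hbd : Function.Injective fun x => (b x, d x)) :
    Summable fun x => Φ (a x) * conj (Φ (b x)) * (Φ (c x) * conj (Φ (d x))) := by
  have h2 := h.mul_of_nonneg h (fun _ => by positivity) (fun _ => by positivity)
  refine Summable.of_norm_bounded ((h2.comp_injective hac).add (h2.comp_injective hbd)) fun x => ?_
  simp only [norm_mul, RCLike.norm_conj, Function.comp]
  nlinarith [sq_nonneg (‖Φ (a x)‖ * ‖Φ (c x)‖ - ‖Φ (b x)‖ * ‖Φ (d x)‖),
    sq_nonneg (‖Φ (a x)‖ * ‖Φ (c x)‖), sq_nonneg (‖Φ (b x)‖ * ‖Φ (d x)‖)]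

theorem summable_mul_conj {Φ : TwoMode} (h : Summable fun p => ‖Φ p‖ ^ 2) (m n : ℕ) :
    Summable fun k => ‖Φ (m, k) * conj (Φ (n, k))‖ := by
  have hi (m : ℕ) : Summable fun k => ‖Φ (m, k)‖ ^ 2 :=
    h.comp_injective (i := fun k => (m, k)) (Prod.mk_right_injective m)
  refine Summable.of_nonneg_of_le (fun _ => norm_nonneg _) (fun k => ?_) ((hi m).add (hi n))
  simp only [norm_mul, RCLike.norm_conj]
  nlinarith [sq_nonneg (‖Φ (m, k)‖ - ‖Φ (n, k)‖), sq_nonneg ‖Φ (m, k)‖, sq_nonneg ‖Φ (n, k)‖]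

theorem reduced_mul_reduced {Φ : TwoMode} (h : Summable fun p => ‖Φ p‖ ^ 2) (i j m n : ℕ) :
    partialTraceB (projector Φ) i j * partialTraceB (projector Φ) m n =
      ∑' q : ℕ × ℕ, Φ (i, q.1) * conj (Φ (j, q.1)) * (Φ (m, q.2) * conj (Φ (n, q.2))) :=
  tsum_mul_tsum_of_summable_norm (summable_mul_conj h i j) (summable_mul_conj h m n)

theorem summable_reduced_mul_reduced {Φ : TwoMode} (h : Summable fun p => ‖Φ p‖ ^ 2) (i j : ℕ) :
    Summable fun k => partialTraceB (projector Φ) i k * partialTraceB (projector Φ) k j := by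
  simp only [reduced_mul_reduced h]
  refine (summable_overlap h (fun x : ℕ × (ℕ × ℕ) => (i, x.2.1)) (fun x => (x.1, x.2.1))
    (fun x => (x.1, x.2.2)) (fun x => (j, x.2.2)) ?_ ?_).prod
  all_goals
    rintro ⟨a, b, c⟩ ⟨a', b', c'⟩ hh
    simp_all

/-- The summand of `Tr[ρ ^ 2]`, indexed by the photon numbers `((m, n), (k, l))` of the two
copies of the modes `a` and `b`. -/
def purityTerm (Φ : TwoMode) (q : (ℕ × ℕ) × (ℕ × ℕ)) : ℂ :=
  Φ (q.1.1, q.2.1) * conj (Φ (q.1.2, q.2.1)) * (Φ (q.1.2, q.2.2) * conj (Φ (q.1.1, q.2.2)))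

theorem summable_purityTerm {Φ : TwoMode} (h : Summable fun p => ‖Φ p‖ ^ 2) :
    Summable (purityTerm Φ) := by
  refine summable_overlap h (fun q : (ℕ × ℕ) × (ℕ × ℕ) => (q.1.1, q.2.1)) (fun q => (q.1.2, q.2.1))
    (fun q => (q.1.2, q.2.2)) (fun q => (q.1.1, q.2.2)) ?_ ?_
  all_goals
    rintro ⟨⟨a, b⟩, c, d⟩ ⟨⟨a', b'⟩, c', d'⟩ hh
    simp_all

theorem hasSum_trace_sq {Φ : TwoMode} (h : Summable fun p => ‖Φ p‖ ^ 2) :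
    HasSum (fun m => matMul (partialTraceB (projector Φ)) (partialTraceB (projector Φ)) m m)
      (∑' q, purityTerm Φ q) := by
  have hs := summable_purityTerm h
  have h1 := hs.hasSum.prod_fiberwise fun p => (hs.prod_factor p).hasSum
  have h2 : HasSum (fun p : ℕ × ℕ =>
      partialTraceB (projector Φ) p.1 p.2 * partialTraceB (projector Φ) p.2 p.1)
      (∑' q, purityTerm Φ q) := by
    simp only [reduced_mul_reduced h]
    exact h1
  exact h2.prod_fiberwise fun m => (h2.summable.prod_factor m).hasSum

/-- In each sector of fixed photon number this is the binomial theorem for T + (1-T) = 1. -/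
theorem hasSum_norm_outputState {ψ : Mode} {S T : ℝ} (hψ : HasSum (fun n => ‖ψ n‖ ^ 2) S)
    (hT : T ∈ Set.Icc (0 : ℝ) 1) : HasSum (fun p => ‖outputState ψ T p‖ ^ 2) S := by
  have h1 : 0 ≤ 1 - T := by linarith [hT.2]
  have h0 := hT.1
  refine hasSum_of_hasSum_antidiagonal (fun _ => by positivity) ?_
  convert hψ using 2 with N
  calc ∑ p ∈ antidiagonal N, ‖outputState ψ T p‖ ^ 2
      = ∑ p ∈ antidiagonal N, ‖ψ N‖ ^ 2 * (N.choose p.1 • (T ^ p.1 * (1 - T) ^ p.2)) := by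
        refine Finset.sum_congr rfl ?_
        rintro ⟨m, k⟩ hp
        rw [Finset.HasAntidiagonal.mem_antidiagonal] at hp
        simp only at hp
        subst hp
        rw [outputState_apply ψ hT, norm_mul, mul_pow, Complex.norm_real, Real.norm_eq_abs, sq_abs,
          Real.sq_sqrt (by positivity), nsmul_eq_mul, mul_assoc (Nat.cast _)]
    _ = ‖ψ N‖ ^ 2 := by
        rw [← Finset.mul_sum, ← (Commute.all T (1 - T)).add_pow']
        simp

/-! ### The beam splitter identity -/

theorem cast_choose_mul_factorial_mul_factorial (m k : ℕ) :
    ((m + k).choose m : ℝ) * m ! * k ! = (m + k)! := by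
  have := Nat.choose_mul_factorial_mul_factorial (Nat.le_add_right m k)
  rw [Nat.add_sub_cancel_left] at this
  exact_mod_cast this

theorem inv_factorial_smul_add_pow {R : Type*} [CommRing R] [Algebra ℝ R] (α β : R) (N : ℕ) :
    ((N ! : ℝ)⁻¹) • (α + β) ^ N = ∑ p ∈ antidiagonal N,
      (((p.1 ! : ℝ)⁻¹) • α ^ p.1) * (((p.2 ! : ℝ)⁻¹) • β ^ p.2) := by
  rw [(Commute.all α β).add_pow', Finset.smul_sum]
  refine Finset.sum_congr rfl ?_
  rintro ⟨m, k⟩ hp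
  rw [Finset.HasAntidiagonal.mem_antidiagonal] at hp
  simp only at hp
  subst hp
  have hc := cast_choose_mul_factorial_mul_factorial m k
  rw [← Nat.cast_smul_eq_nsmul ℝ, smul_smul, smul_mul_smul_comm]
  congr 1
  have := Nat.cast_ne_zero (R := ℝ).mpr (Nat.factorial_ne_zero (m + k))
  field_simp
  linarith

/-- Both sides expand the N-th power, over N!, of the bilinear form in `hexp`; the right side uses
its diagonalisation by sums and differences. -/
theorem multinomial_beamSplitter_identity {R : Type*} [CommRing R] [Algebra ℝ R] (x y u v : R)
    (T : ℝ) (N : ℕ) :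
    ∑ st ∈ antidiagonal N, ∑ q ∈ antidiagonal st.1 ×ˢ antidiagonal st.2,
      (T ^ (q.1.1 + q.1.2) * (1 - T) ^ (q.2.1 + q.2.2) /
        (q.1.1 ! * q.1.2 ! * q.2.1 ! * q.2.2 ! : ℝ)) •
        ((x ^ (q.1.1 + q.2.1) * y ^ (q.1.2 + q.2.2)) *
          (u ^ (q.1.2 + q.2.1) * v ^ (q.1.1 + q.2.2))) =
    ∑ p ∈ antidiagonal N, ((1 - 2 * T) ^ p.1 / (p.1 ! * p.2 ! * 2 ^ (p.1 + p.2) : ℝ)) •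
      (((x - y) ^ p.1 * (x + y) ^ p.2) * ((u - v) ^ p.1 * (u + v) ^ p.2)) := by
  have hexp : (T • (x * v) + T • (y * u)) + ((1 - T) • (x * u) + (1 - T) • (y * v)) =
      ((1 - 2 * T) / 2) • ((x - y) * (u - v)) + (1 / 2 : ℝ) • ((x + y) * (u + v)) := by
    have hA : ∀ r : ℝ, ∀ z : R, r • z = algebraMap ℝ R r * z := fun r z => Algebra.smul_def r z
    have h2 : (2 : R) * algebraMap ℝ R (1 / 2) = 1 := by
      rw [← map_ofNat (algebraMap ℝ R) 2, ← map_mul]; norm_num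
    simp only [hA]
    rw [show (1 - 2 * T) / 2 = 1 / 2 - T by ring]
    simp only [map_sub, map_one]
    linear_combination (-(x * u) - (y * v)) * h2
  have h := congrArg (fun z => ((N ! : ℝ)⁻¹) • z ^ N) hexp
  simp only [inv_factorial_smul_add_pow, Finset.sum_mul_sum, ← Finset.sum_product'] at h
  convert h using 2 with st _ p _
  · refine Finset.sum_congr rfl fun q _ => ?_
    simp only [smul_pow, smul_smul, smul_mul_smul_comm]
    congr 1
    · simp only [pow_add]; field_simp
    · ring
  · simp only [smul_pow, smul_smul, smul_mul_smul_comm]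
    congr 1
    · simp only [pow_add, div_pow, one_pow]; field_simp
    · simp only [mul_pow]; ring

/-! ### Amplitudes of two copies of the state -/

/-- The linear functional on polynomials in two variables sending `x ^ i * y ^ j` to
`f i * f j`. -/
def pairFunctional (f : ℕ → ℂ) : MvPolynomial (Fin 2) ℝ →ₗ[ℝ] ℂ :=
  (MvPolynomial.basisMonomials (Fin 2) ℝ).constr ℝ fun s => f (s 0) * f (s 1)

theorem pairFunctional_monomial (f : ℕ → ℂ) (s : Fin 2 →₀ ℕ) :
    pairFunctional f (MvPolynomial.monomial s 1) = f (s 0) * f (s 1) := by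
  have h := (MvPolynomial.basisMonomials (Fin 2) ℝ).constr_basis ℝ
    (fun s => f (s 0) * f (s 1)) s
  rwa [MvPolynomial.coe_basisMonomials] at h

theorem pairFunctional_pow (f : ℕ → ℂ) (i j : ℕ) :
    pairFunctional f (MvPolynomial.X 0 ^ i * MvPolynomial.X 1 ^ j) = f i * f j := by
  rw [MvPolynomial.X_pow_eq_monomial, MvPolynomial.X_pow_eq_monomial, MvPolynomial.monomial_mul,
    one_mul, pairFunctional_monomial]
  simp

theorem pairFunctional_swap (f : ℕ → ℂ) (z : MvPolynomial (Fin 2) ℝ) :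
    pairFunctional f (MvPolynomial.rename (Equiv.swap 0 1) z) = pairFunctional f z := by
  have h : pairFunctional f ∘ₗ (MvPolynomial.rename (Equiv.swap (0 : Fin 2) 1)).toLinearMap =
      pairFunctional f := by
    refine (MvPolynomial.basisMonomials (Fin 2) ℝ).ext fun s => ?_
    simp only [MvPolynomial.coe_basisMonomials, LinearMap.comp_apply, AlgHom.toLinearMap_apply,
      MvPolynomial.rename_monomial, pairFunctional_monomial, Finsupp.mapDomain_equiv_apply]
    simp [mul_comm]
  exact LinearMap.congr_fun h z

/-- The amplitude of the state `f ⊗ f` on the polynomial `(x - y) ^ r * (x + y) ^ t`. -/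
def pairAmplitude (f : ℕ → ℂ) (p : ℕ × ℕ) : ℂ :=
  pairFunctional f ((MvPolynomial.X 0 - MvPolynomial.X 1) ^ p.1 *
    (MvPolynomial.X 0 + MvPolynomial.X 1) ^ p.2)

/-- Exchanging the variables preserves the functional but multiplies the polynomial by (-1)^r. -/
theorem pairAmplitude_odd (f : ℕ → ℂ) {r : ℕ} (hr : Odd r) (t : ℕ) :
    pairAmplitude f (r, t) = 0 := by
  have h := pairFunctional_swap f
    ((MvPolynomial.X 0 - MvPolynomial.X 1) ^ r * (MvPolynomial.X 0 + MvPolynomial.X 1) ^ t)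
  simp only [map_mul, map_pow, map_sub, map_add, MvPolynomial.rename_X, Equiv.swap_apply_left,
    Equiv.swap_apply_right] at h
  rw [← neg_sub (MvPolynomial.X 0), hr.neg_pow, add_comm (MvPolynomial.X 1), neg_mul, map_neg] at h
  exact self_eq_neg.mp h.symm

theorem map_beamSplitter_identity {A : Type*} [CommRing A] [Algebra ℝ A] (Λ : A →ₗ[ℝ] ℂ) (x y : A)
    (T : ℝ) (N : ℕ) :
    ∑ st ∈ antidiagonal N, ∑ q ∈ antidiagonal st.1 ×ˢ antidiagonal st.2,
      ((T ^ (q.1.1 + q.1.2) * (1 - T) ^ (q.2.1 + q.2.2) /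
        (q.1.1 ! * q.1.2 ! * q.2.1 ! * q.2.2 ! : ℝ) : ℝ) : ℂ) *
        (Λ (x ^ (q.1.1 + q.2.1) * y ^ (q.1.2 + q.2.2)) *
          conj (Λ (x ^ (q.1.2 + q.2.1) * y ^ (q.1.1 + q.2.2)))) =
    ((∑ p ∈ antidiagonal N, (1 - 2 * T) ^ p.1 *
      (‖Λ ((x - y) ^ p.1 * (x + y) ^ p.2)‖ ^ 2 / (p.1 ! * p.2 ! * 2 ^ (p.1 + p.2))) : ℝ) : ℂ) := by
  -- The tensor square makes (x, y) and (u, v) independent. `L` is Λ on the first factor times its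
  -- conjugate on the second, so equal arguments give a squared modulus.
  let L : A ⊗[ℝ] A →ₗ[ℝ] ℂ := TensorProduct.lift ((LinearMap.mul ℝ ℂ).compl₁₂ Λ
    (Complex.conjAe.toLinearMap ∘ₗ Λ))
  have hL (a b : A) : L (Algebra.TensorProduct.includeLeft (R := ℝ) (S := ℝ) (B := A) a *
      Algebra.TensorProduct.includeRight (R := ℝ) (A := A) b) = Λ a * conj (Λ b) := by
    simp [L]
  generalize Algebra.TensorProduct.includeLeft (R := ℝ) (S := ℝ) (A := A) (B := A) = il at hL
  generalize Algebra.TensorProduct.includeRight (R := ℝ) (A := A) (B := A) = ir at hL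
  have h := congrArg L (multinomial_beamSplitter_identity (il x) (il y) (ir x) (ir y) T N)
  simp only [← map_pow, ← map_mul, ← map_sub, ← map_add il, ← map_add ir] at h
  simp only [map_sum, map_smul, hL, Complex.real_smul] at h
  rw [h, Complex.ofReal_sum]
  refine Finset.sum_congr rfl fun p _ => ?_
  rw [Complex.mul_conj, Complex.normSq_eq_norm_sq]
  push_cast
  ring

theorem sum_beamSplitter_kernel (f : ℕ → ℂ) (T : ℝ) (N : ℕ) :
    ∑ st ∈ antidiagonal N, ∑ q ∈ antidiagonal st.1 ×ˢ antidiagonal st.2,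
      ((T ^ (q.1.1 + q.1.2) * (1 - T) ^ (q.2.1 + q.2.2) /
        (q.1.1 ! * q.1.2 ! * q.2.1 ! * q.2.2 ! : ℝ) : ℝ) : ℂ) *
        ((f (q.1.1 + q.2.1) * f (q.1.2 + q.2.2)) *
          conj (f (q.1.2 + q.2.1) * f (q.1.1 + q.2.2))) =
    ((∑ p ∈ antidiagonal N, (1 - 2 * T) ^ p.1 *
      (‖pairAmplitude f p‖ ^ 2 / (p.1 ! * p.2 ! * 2 ^ (p.1 + p.2))) : ℝ) : ℂ) := by
  have h := map_beamSplitter_identity (pairFunctional f) (MvPolynomial.X 0) (MvPolynomial.X 1) T N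
  simp only [pairFunctional_pow] at h
  exact h

/-! ### The purity as a sum of nonnegative weights -/

theorem sqrt_choose_mul_eq {T : ℝ} (hT : T ∈ Set.Icc (0 : ℝ) 1) (m k : ℕ) :
    √((m + k).choose m * T ^ m * (1 - T) ^ k) =
      √((m + k)! : ℝ) * (√(T ^ m / m !) * √((1 - T) ^ k / k !)) := by
  have h1 : 0 ≤ 1 - T := by linarith [hT.2]
  have h0 := hT.1
  rw [← Real.sqrt_mul (by positivity), ← Real.sqrt_mul (by positivity)]
  have hc := cast_choose_mul_factorial_mul_factorial m k
  rw [← hc]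
  congr 1
  field_simp

/-- Each of m, n, k, l enters two of the four amplitudes, so its square roots pair off; the
remaining √(N!) factors are absorbed in `f`. -/
theorem purityTerm_outputState (ψ : Mode) {T : ℝ} (hT : T ∈ Set.Icc (0 : ℝ) 1)
    (q : (ℕ × ℕ) × (ℕ × ℕ)) (f : ℕ → ℂ) (hf : ∀ n, f n = ψ n * (√(n ! : ℝ) : ℝ)) :
    purityTerm (outputState ψ T) q =
      ((T ^ (q.1.1 + q.1.2) * (1 - T) ^ (q.2.1 + q.2.2) /
        (q.1.1 ! * q.1.2 ! * q.2.1 ! * q.2.2 ! : ℝ) : ℝ) : ℂ) *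
        ((f (q.1.1 + q.2.1) * f (q.1.2 + q.2.2)) *
          conj (f (q.1.2 + q.2.1) * f (q.1.1 + q.2.2))) := by
  obtain ⟨⟨m, n⟩, k, l⟩ := q
  have h1 : 0 ≤ 1 - T := by linarith [hT.2]
  have h0 := hT.1
  have ha (m : ℕ) : ((√(T ^ m / m !) : ℝ) : ℂ) * (√(T ^ m / m !) : ℝ) = ((T ^ m / m ! : ℝ) : ℂ) := by
    rw [← Complex.ofReal_mul, Real.mul_self_sqrt (by positivity)]
  have hb (m : ℕ) : ((√((1 - T) ^ m / m !) : ℝ) : ℂ) * (√((1 - T) ^ m / m !) : ℝ) =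
      (((1 - T) ^ m / m ! : ℝ) : ℂ) := by
    rw [← Complex.ofReal_mul, Real.mul_self_sqrt (by positivity)]
  have hw : ((T ^ (m + n) * (1 - T) ^ (k + l) / (m ! * n ! * k ! * l ! : ℝ) : ℝ) : ℂ) =
      ((T ^ m / m ! : ℝ) : ℂ) * ((T ^ n / n ! : ℝ) : ℂ) * (((1 - T) ^ k / k ! : ℝ) : ℂ) *
        (((1 - T) ^ l / l ! : ℝ) : ℂ) := by
    simp only [← Complex.ofReal_mul, pow_add]
    congr 1
    field_simp
  simp only [purityTerm, hw, ← ha, ← hb, outputState_apply ψ hT, sqrt_choose_mul_eq hT, hf, map_mul,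
    Complex.conj_ofReal, Complex.ofReal_mul]
  ring

/-- The weight of `(1 - 2 T) ^ r` contributed by the sector with `r + t` photons in total: the
probability of finding `r` and `t` photons behind a balanced beam splitter fed with `ψ ⊗ ψ`. -/
def purityWeight (ψ : Mode) (p : ℕ × ℕ) : ℝ :=
  ‖pairAmplitude (fun n => ψ n * (√(n ! : ℝ) : ℝ)) p‖ ^ 2 / (p.1 ! * p.2 ! * 2 ^ (p.1 + p.2))

theorem purityWeight_nonneg (ψ : Mode) (p : ℕ × ℕ) : 0 ≤ purityWeight ψ p := by
  unfold purityWeight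
  positivity

theorem purityWeight_odd (ψ : Mode) {r : ℕ} (hr : Odd r) (t : ℕ) : purityWeight ψ (r, t) = 0 := by
  simp [purityWeight, pairAmplitude_odd _ hr]

theorem hasSum_antidiagonal_purityWeight {ψ : Mode} (hψ : Summable fun n => ‖ψ n‖ ^ 2) {T : ℝ}
    (hT : T ∈ Set.Icc (0 : ℝ) 1) :
    HasSum (fun N => ((∑ p ∈ antidiagonal N, (1 - 2 * T) ^ p.1 * purityWeight ψ p : ℝ) : ℂ))
      (∑' q, purityTerm (outputState ψ T) q) := by
  have h := (summable_purityTerm (hasSum_norm_outputState hψ.hasSum hT).summable).hasSum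
  have h1 := hasSum_sum_fiber h (fun q => (q.1.1 + q.1.2, q.2.1 + q.2.2))
    (fun st => antidiagonal st.1 ×ˢ antidiagonal st.2) (by rintro ⟨⟨a, b⟩, c, d⟩ ⟨s, t⟩; simp)
  have h2 := hasSum_sum_fiber h1 (fun p => p.1 + p.2) antidiagonal (by simp)
  have e (N : ℕ) : ((∑ p ∈ antidiagonal N, (1 - 2 * T) ^ p.1 * purityWeight ψ p : ℝ) : ℂ) =
      ∑ st ∈ antidiagonal N, ∑ q ∈ antidiagonal st.1 ×ˢ antidiagonal st.2,
        purityTerm (outputState ψ T) q := by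
    refine (sum_beamSplitter_kernel _ T N).symm.trans ?_
    exact Finset.sum_congr rfl fun st _ => Finset.sum_congr rfl fun q _ =>
      (purityTerm_outputState ψ hT q _ fun _ => rfl).symm
  simp only [e]
  exact h2

theorem summable_purityWeight {ψ : Mode} (hψ : Summable fun n => ‖ψ n‖ ^ 2) :
    Summable (purityWeight ψ) := by
  -- At T = 0 every power of 1-2T is 1, leaving the bare weights.
  have h := (hasSum_antidiagonal_purityWeight hψ (T := 0) (by simp)).summable
  simp only [mul_zero, sub_zero, one_pow, one_mul] at h
  exact (hasSum_of_hasSum_antidiagonal (purityWeight_nonneg ψ)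
    (Complex.summable_ofReal.mp h).hasSum).summable

/-- The coefficients of the purity as a power series in `1 - 2 T`. -/
def purityCoeff (ψ : Mode) (r : ℕ) : ℝ := ∑' t, purityWeight ψ (r, t)

theorem summable_purityCoeff {ψ : Mode} (hψ : Summable fun n => ‖ψ n‖ ^ 2) :
    Summable (purityCoeff ψ) := (summable_purityWeight hψ).prod

/-- The second conjunct shows that the trace is real, so the real part in `purity` discards nothing.
-/
theorem hasSum_purityCoeff {ψ : Mode} (hψ : Summable fun n => ‖ψ n‖ ^ 2) {T : ℝ}
    (hT : T ∈ Set.Icc (0 : ℝ) 1) :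
    HasSum (fun r => purityCoeff ψ r * (1 - 2 * T) ^ r) (purity ψ T) ∧
      ∑' q, purityTerm (outputState ψ T) q = (purity ψ T : ℂ) := by
  have hw : Summable fun p : ℕ × ℕ => (1 - 2 * T) ^ p.1 * purityWeight ψ p := by
    refine Summable.of_norm_bounded (summable_purityWeight hψ) fun p => ?_
    rw [norm_mul, norm_pow, Real.norm_of_nonneg (purityWeight_nonneg ψ p)]
    refine mul_le_of_le_one_left (purityWeight_nonneg ψ p) (pow_le_one₀ (norm_nonneg _) ?_)
    rw [Real.norm_eq_abs, abs_le]
    constructor <;> linarith [hT.1, hT.2]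
  have h1 := hasSum_sum_fiber hw.hasSum (fun p => p.1 + p.2) antidiagonal (by simp)
  have h2 := (hasSum_antidiagonal_purityWeight hψ hT).unique (Complex.hasSum_ofReal.mpr h1)
  have h3 : purity ψ T = ∑' p : ℕ × ℕ, (1 - 2 * T) ^ p.1 * purityWeight ψ p := by
    have h4 := (hasSum_trace_sq (hasSum_norm_outputState hψ.hasSum hT).summable).tsum_eq
    rw [h2] at h4
    exact congrArg Complex.re h4
  refine ⟨?_, by rw [h2, h3]⟩
  have h5 := hw.hasSum.prod_fiberwise fun r => (hw.prod_factor r).hasSum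
  rw [h3]
  simpa only [tsum_mul_left, purityCoeff, mul_comm] using h5

/-! ### Smoothness and convexity of power series -/

/-- Absolute summability at x = 1 gives radius of convergence at least 1, hence analyticity inside.
-/
theorem contDiffOn_of_hasSum_pow {c : ℕ → ℝ} (hc : Summable fun n => ‖c n‖) {g : ℝ → ℝ}
    (hg : ∀ x ∈ Set.Ioo (-1 : ℝ) 1, HasSum (fun n => c n * x ^ n) (g x)) (n : WithTop ℕ∞) :
    ContDiffOn ℝ n g (Set.Ioo (-1) 1) := by
  let p := FormalMultilinearSeries.ofScalars ℝ c
  have hr : (1 : NNReal) ≤ p.radius := by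
    refine p.le_radius_of_summable_norm ?_
    simpa [p, FormalMultilinearSeries.ofScalars_norm] using hc
  have hr0 : 0 < p.radius := lt_of_lt_of_le (by simp) hr
  have hp := (p.hasFPowerSeriesOnBall hr0).mono (r' := 1) (by simp) (by simpa using hr)
  have han : AnalyticOnNhd ℝ p.sum (Set.Ioo (-1) 1) := by
    intro x hx
    refine hp.analyticAt_of_mem ?_
    rw [mem_eball_zero_iff]
    rw [← ofReal_norm, ENNReal.ofReal_lt_one, Real.norm_eq_abs, abs_lt]
    exact hx
  refine (han.contDiffOn (uniqueDiffOn_Ioo _ _)).congr fun x hx => ?_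
  rw [← (hg x hx).tsum_eq]
  simp [p, FormalMultilinearSeries.sum, FormalMultilinearSeries.ofScalars]

/-- Even powers of an affine function are convex, and the inequality survives summation with
nonnegative coefficients. -/
theorem convexOn_of_hasSum_even_pow {c : ℕ → ℝ} (hc : ∀ n, 0 ≤ c n) (hodd : ∀ n, Odd n → c n = 0)
    {s : Set ℝ} (hs : Convex ℝ s) {g : ℝ → ℝ}
    (hg : ∀ x ∈ s, HasSum (fun n => c n * (1 - 2 * x) ^ n) (g x)) : ConvexOn ℝ s g := by
  refine ⟨hs, fun x hx y hy a b ha hb hab => ?_⟩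
  refine hasSum_le (fun n => ?_) (hg _ (hs hx hy ha hb hab))
    (((hg x hx).const_smul a).add ((hg y hy).const_smul b))
  rcases Nat.even_or_odd n with hn | hn
  · have h := hn.convexOn_pow (𝕜 := ℝ) |>.2 (Set.mem_univ (1 - 2 * x)) (Set.mem_univ (1 - 2 * y))
      ha hb hab
    have e : 1 - 2 * (a • x + b • y) = a • (1 - 2 * x) + b • (1 - 2 * y) := by
      simp only [smul_eq_mul]
      linear_combination -hab
    rw [e]
    have := mul_le_mul_of_nonneg_left h (hc n)
    simp only [smul_eq_mul] at this ⊢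
    linarith
  · simp [hodd n hn]

theorem iteratedDeriv_two_nonneg_of_convexOn {s : Set ℝ} (hs : IsOpen s) {g : ℝ → ℝ}
    (hg : ConvexOn ℝ s g) (hd : DifferentiableOn ℝ g s) {x : ℝ} (hx : x ∈ s) :
    0 ≤ iteratedDeriv 2 g x := by
  have hm : MonotoneOn (deriv g) s :=
    hg.monotoneOn_deriv fun y hy => (hd y hy).differentiableAt (hs.mem_nhds hy)
  have h := hm.derivWithin_nonneg (x := x)
  rw [derivWithin_of_isOpen hs hx] at h
  rwa [iteratedDeriv_succ, iteratedDeriv_one]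

end PhotonLoss

end

open PhotonLoss

theorem theorem2 (ψ : lp (fun _ : ℕ => ℂ) 2) (hψ : ‖ψ‖ = 1) :
    -- the objects are well defined: `Ψ_T` is a unit vector, and the series for `Tr[ρ_T ^ 2]`
    -- converge, with real value the purity
    (∀ T ∈ Set.Ioo (0 : ℝ) 1,
      HasSum (fun p : ℕ × ℕ => ‖PhotonLoss.outputState ψ T p‖ ^ 2) 1 ∧
      (∀ i j : ℕ, Summable fun k : ℕ =>
        PhotonLoss.lossyState ψ T i k * PhotonLoss.lossyState ψ T k j) ∧
      HasSum (fun m : ℕ =>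
          PhotonLoss.matMul (PhotonLoss.lossyState ψ T) (PhotonLoss.lossyState ψ T) m m)
        (PhotonLoss.purity ψ T : ℂ)) ∧
    -- the purity is convex, the mixedness concave
    ConvexOn ℝ (Set.Ioo (0 : ℝ) 1) (PhotonLoss.purity ψ) ∧
    ConcaveOn ℝ (Set.Ioo (0 : ℝ) 1) (PhotonLoss.mixedness ψ) ∧
    -- the second derivative of the purity exists and is nonnegative
    ContDiffOn ℝ 2 (PhotonLoss.purity ψ) (Set.Ioo (0 : ℝ) 1) ∧
    (∀ T ∈ Set.Ioo (0 : ℝ) 1, 0 ≤ iteratedDeriv 2 (PhotonLoss.purity ψ) T) ∧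
    -- power series in `1 - 2T` with nonnegative coefficients and even powers only
    ∃ c : ℕ → ℝ, (∀ m, 0 ≤ c m) ∧ (∀ m, Odd m → c m = 0) ∧
      ∀ T ∈ Set.Ioo (0 : ℝ) 1,
        HasSum (fun m : ℕ => c m * (1 - 2 * T) ^ m) (PhotonLoss.purity ψ T) := by
  have hp : HasSum (fun n => ‖ψ n‖ ^ 2) 1 := by
    have h := lp.hasSum_norm (p := 2) (by norm_num) ψ
    simpa [hψ] using h
  have hc0 (m : ℕ) : 0 ≤ purityCoeff ψ m := tsum_nonneg fun _ => purityWeight_nonneg _ _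
  have hodd (m : ℕ) (hm : Odd m) : purityCoeff ψ m = 0 := by
    simp [purityCoeff, purityWeight_odd _ hm]
  have hsum : ∀ T ∈ Set.Ioo (0 : ℝ) 1,
      HasSum (fun m : ℕ => purityCoeff ψ m * (1 - 2 * T) ^ m) (purity ψ T) := fun T hT =>
    (hasSum_purityCoeff hp.summable (Set.Ioo_subset_Icc_self hT)).1
  have hconv : ConvexOn ℝ (Set.Ioo (0 : ℝ) 1) (purity ψ) :=
    convexOn_of_hasSum_even_pow hc0 hodd (convex_Ioo 0 1) hsum
  have hdiff : ContDiffOn ℝ 2 (purity ψ) (Set.Ioo (0 : ℝ) 1) := by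
    -- The variable x = 1-2T carries (0, 1) onto (-1, 1), where the series is centred at 0.
    have h := contDiffOn_of_hasSum_pow (g := fun x => purity ψ ((1 - x) / 2))
      (summable_purityCoeff hp.summable).norm (fun x hx => by
        have := hsum ((1 - x) / 2) ⟨by linarith [hx.2], by linarith [hx.1]⟩
        rwa [show 1 - 2 * ((1 - x) / 2) = x by ring] at this) 2
    have h2 := h.comp (g := fun x => purity ψ ((1 - x) / 2)) (f := fun T : ℝ => 1 - 2 * T)
      (s := Set.Ioo 0 1) (by fun_prop) (fun T hT => ⟨by linarith [hT.2], by linarith [hT.1]⟩)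
    refine h2.congr fun T _ => ?_
    simp only [Function.comp]
    congr 1
    ring
  refine ⟨fun T hT => ?_, hconv, ?_, hdiff, fun T hT => ?_, purityCoeff ψ, hc0, hodd, hsum⟩
  · have hT' := Set.Ioo_subset_Icc_self hT
    have hn := hasSum_norm_outputState hp hT'
    refine ⟨hn, summable_reduced_mul_reduced hn.summable, ?_⟩
    rw [← (hasSum_purityCoeff hp.summable hT').2]
    exact hasSum_trace_sq hn.summable
  · exact (concaveOn_const 1 (convex_Ioo 0 1)).sub hconv
  · exact iteratedDeriv_two_nonneg_of_convexOn isOpen_Ioo hconv (hdiff.differentiableOn (by simp)) hT
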